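/- Let $M=(\mathcal S,\mathcal A,p,\mathbf r,\mu,\gamma)$ be a multi-objective Markov decision process with finite state space $\mathcal S$, finite non-empty action space $\mathcal A$, transition probabilities $p(\cdot\mid s,a)$, reward $\mathbf r:\mathcal S\times\mathcal A\times\mathcal S\to\mathbb R^m$ with $m\ge 1$ objectives, initial state distribution $\mu$ and discount factor $\gamma\in[0,1)$. A policy is a map $\pi:\mathcal S\to\mathcal A$. Its action-values are $\mathbf q^\pi(s,a)=\mathbb E_\pi\big[\sum_{t\ge 0}\gamma^t\,\mathbf r(S_t,A_t,S_{t+1})\mid S_0=s,A_0=a\big]$, and its value vector is $\mathbf v^\pi=\mathbb E_{S_0\sim\mu}[\mathbf q^\pi(S_0,\pi(S_0))]$. For $\mathbf w$ in the simplex $\mathcal W=\{\mathbf w\in\mathbb R^m: w_i\ge 0,\ \sum_i w_i=1\}$ put $v^\pi_{\mathbf w}=\mathbf v^\pi\cdot\mathbf w$ and $q^\pi_{\mathbf w}=\mathbf q^\pi\cdot\mathbf w$; $\pi$ is optimal for $\mathbf w$ if $v^\pi_{\mathbf w}\ge v^{\pi'}_{\mathbf w}$ for all policies $\pi'$. A convex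 coverage set (CCS) is a finite set of value vectors of policies, each of which is optimal for some $\mathbf w\in\mathcal W$, that contains for every $\mathbf w\in\mathcal W$ the value vector of a policy that is optimal for $\mathbf w$. The Pareto frontier $\mathcal F$ is the set of the value vectors $\mathbf v^\pi$ such that no $\mathbf v^{\pi'}$ is at least as large in every coordinate and larger in some coordinate. For a finite set $\mathcal V\subset\mathbb R^m$, the corner weights of $\mathcal V$ are the $\mathbf w$-components of the vertices $(\mathbf w,t)$ of the polyhedron $\{(\mathbf w,t)\in\mathbb R^{m+1}:\ \mathbf w\in\mathcal W,\ \mathbf v\cdot\mathbf w\le t\ \text{for all } \mathbf v\in\mathcal V\}$. The GPI policy for a set $\Pi$ of policies and a weight $\mathbf w$ takes in each state $s$ an action in $\arg\max_a\max_{\pi\in\Pi}q^\pi_{\mathbf w}(s,a)$; its scalarized value is $v^{\mathrm{GPI}}_{\mathbf w}$. GPI Linear Support works as follows. Let $\pi$ be the policy returned by $\mathrm{NewPolicy}$ for $\mathbf w=(1,0,\dots,0)$; set $\Pi=\{\pi\}$, $\mathcal V=\{\mathbf v^{\pi}\}$ and $\mathcal M=\emptyset$. Then repeat: let $\mathcal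 W_{\mathrm{corner}}$ be the set of the corner weights of $\mathcal V$ that are not in $\mathcal M$; if it is empty, return $\Pi,\mathcal V$. Otherwise choose $\mathbf w\in\arg\max_{\mathbf w\in\mathcal W_{\mathrm{corner}}}\big(v^{\mathrm{GPI}}_{\mathbf w}-\max_{\pi\in\Pi}v^\pi_{\mathbf w}\big)$ and call $\mathrm{NewPolicy}(\mathbf w,\Pi)$, which returns a policy and a flag $\mathrm{done}$; if $\mathrm{done}$ holds, add $\mathbf w$ to $\mathcal M$; add the policy to $\Pi$ and its value vector to $\mathcal V$; remove the dominated policies. This last step removes every policy that is best in $\Pi$ for no weight in $\mathcal W$, and keeps every value vector that is the only best one for some weight in $\mathcal W$; policies that are best only in ties, and duplicates of the same value vector, may be kept or removed. All ties in the $\arg\max$'s may be broken in any way. **Theorem.** There is a number $N$, depending only on $M$, such that the following holds. Suppose that $\mathrm{NewPolicy}(\mathbf w,\Pi)$ always returns an optimal policy for the weight vector $\mathbf w$ that it is given, with $\mathrm{done}$ true. Then every run of GPI Linear Support returns after at most $N$ iterations, and the returned set $\mathcal V$ is a CCS. Moreover $\mathcal V\cap\mathcal F$ is a CCS, and every value vector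 in $\mathcal V$ that is the only best one in $\mathcal V$ for some weight in $\mathcal W$ lies in $\mathcal F$ (so $\mathcal V\subseteq\mathcal F$ if the removal step also discards the policies that are best only in ties). -/

import Mathlib

open MeasureTheory ProbabilityTheory

/-- A multi-objective Markov decision process with state space `S`, action space `A` and
`m` objectives. -/
structure MOMDP (S A : Type*) (m : ℕ) where
  /-- the distribution over next states -/
  p : S → A → PMF S
  /-- the vector-valued reward `r(s, a, s')` -/
  r : S → A → S → Fin m → ℝ
  /-- the initial state distribution -/
  μ : PMF S
  /-- the discount factor -/
  γ : ℝ
  γ_nonneg : 0 ≤ γ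
  γ_lt_one : γ < 1

namespace MOMDP

section Values

variable {S A : Type*} {m : ℕ} [Finite S] [Finite A]
  [MeasurableSpace S] [DiscreteMeasurableSpace S]
  [MeasurableSpace A] [DiscreteMeasurableSpace A]

/-- One transition of the state-action process under the policy `π`:
from `(s, a)`, draw `s'` from `p(· | s, a)` and then take the action `π s'`. -/
noncomputable def stepKernel (M : MOMDP S A m) (π : S → A) : Kernel (S × A) (S × A) where
  toFun x := ((M.p x.1 x.2).map fun s' => (s', π s')).toMeasure
  measurable' := Measurable.of_discrete

instance (M : MOMDP S A m) (π : S → A) : IsMarkovKernel (M.stepKernel π) :=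
  ⟨fun x => PMF.toMeasure.isProbabilityMeasure ((M.p x.1 x.2).map fun s' => (s', π s'))⟩

/-- The transition after time `n`, as a kernel on histories: only the present matters. -/
noncomputable def historyKernel (M : MOMDP S A m) (π : S → A) (n : ℕ) :
    Kernel ((i : Finset.Iic n) → (fun _ : ℕ => S × A) i) ((fun _ : ℕ => S × A) (n + 1)) :=
  (M.stepKernel π).comap
    (fun h : (i : Finset.Iic n) → S × A => h ⟨n, Finset.mem_Iic.2 le_rfl⟩)
    (measurable_pi_apply _)

instance (M : MOMDP S A m) (π : S → A) (n : ℕ) : IsMarkovKernel (M.historyKernel π n) := by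
  unfold historyKernel; infer_instance

/-- The law of the trajectory `(S_t, A_t)` for `t = 0, 1, 2, …`, started from `S_0 = s`, `A_0 = a`,
following the policy `π` from time `1` on. -/
noncomputable def trajLaw (M : MOMDP S A m) (π : S → A) (s : S) (a : A) :
    Measure (ℕ → S × A) :=
  Kernel.traj (X := fun _ : ℕ => S × A) (M.historyKernel π) 0 (fun _ => (s, a))

/-- The multi-objective action-value function: the expected discounted return
of each objective. -/
noncomputable def q (M : MOMDP S A m) (π : S → A) (s : S) (a : A) : Fin m → ℝ := fun i =>
  ∫ x, (∑' t : ℕ, M.γ ^ t * M.r (x t).1 (x t).2 (x (t + 1)).1 i) ∂(M.trajLaw π s a)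

/-- The multi-objective value vector of a policy under the initial state distribution. -/
noncomputable def v (M : MOMDP S A m) (π : S → A) : Fin m → ℝ := fun i =>
  ∫ s, M.q π s (π s) i ∂M.μ.toMeasure

/-- The scalarized action-value of a policy for the weight vector `w`. -/
noncomputable def qw (M : MOMDP S A m) (w : Fin m → ℝ) (π : S → A) (s : S) (a : A) : ℝ :=
  M.q π s a ⬝ᵥ w

/-- The scalarized value of a policy for the weight vector `w`. -/
noncomputable def vw (M : MOMDP S A m) (w : Fin m → ℝ) (π : S → A) : ℝ :=
  M.v π ⬝ᵥ w

/-- The value vectors of a set of policies. -/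
def valueSet (M : MOMDP S A m) (Pol : Set (S → A)) : Set (Fin m → ℝ) := M.v '' Pol

/-- `π` is an optimal policy for the weight vector `w`. -/
def IsOptimal (M : MOMDP S A m) (w : Fin m → ℝ) (π : S → A) : Prop :=
  ∀ π' : S → A, M.vw w π' ≤ M.vw w π

/-- Pareto dominance of vectors: `a` dominates `b`. -/
def ParetoDom (a b : Fin m → ℝ) : Prop := (∀ i, b i ≤ a i) ∧ ∃ i, b i < a i

/-- The Pareto frontier: the value vectors not Pareto dominated by another value vector. -/
def paretoFrontier (M : MOMDP S A m) : Set (Fin m → ℝ) :=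
  {u | ∃ π : S → A, u = M.v π ∧ ¬ ∃ π' : S → A, ParetoDom (M.v π') (M.v π)}

/-- A convex coverage set: a finite set of value vectors of policies, each of which is
optimal for some weight vector, and which contains an optimal one for every weight vector. -/
structure IsCCS (M : MOMDP S A m) (C : Set (Fin m → ℝ)) : Prop where
  finite : C.Finite
  optimal_somewhere : ∀ u ∈ C, ∃ π : S → A, u = M.v π ∧
    ∃ w ∈ stdSimplex ℝ (Fin m), M.IsOptimal w π
  covers : ∀ w ∈ stdSimplex ℝ (Fin m), ∃ π : S → A, M.v π ∈ C ∧ M.IsOptimal w π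

/-- The largest scalarized value, for the weight vector `w`, of the policies in `Pol`. -/
noncomputable def bestVw (M : MOMDP S A m) (Pol : Set (S → A)) (w : Fin m → ℝ) : ℝ :=
  sSup ((fun π => M.vw w π) '' Pol)

/-- `g` is a GPI policy for the set of policies `Pol` and the weight vector `w`: in every state
it takes an action maximizing the largest scalarized action-value among the policies in `Pol`. -/
def IsGPIPolicy (M : MOMDP S A m) (Pol : Set (S → A)) (w : Fin m → ℝ) (g : S → A) : Prop :=
  ∀ s a, sSup ((fun π => M.qw w π s a) '' Pol) ≤ sSup ((fun π => M.qw w π s (g s)) '' Pol)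

/-- The policy `π` is a best one in `Pol` (possibly among others) for the weight vector `w`. -/
def IsBestIn (M : MOMDP S A m) (Pol : Set (S → A)) (w : Fin m → ℝ) (π : S → A) : Prop :=
  ∀ π' ∈ Pol, M.vw w π' ≤ M.vw w π

/-- The value vector of `π` is the only best one in `Pol` for the weight vector `w`. -/
def IsSoleBestIn (M : MOMDP S A m) (Pol : Set (S → A)) (w : Fin m → ℝ) (π : S → A) : Prop :=
  ∀ π' ∈ Pol, M.v π' ≠ M.v π → M.vw w π' < M.vw w π

/-- `Pol'` is a possible result of removing the dominated policies from `Pol`. Every policy that is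
best for no weight vector is removed. A value vector that is the only best one for some weight
vector is kept. Those that are best only in ties, and duplicates, may be kept or removed. -/
structure RemoveDominated (M : MOMDP S A m) (Pol Pol' : Set (S → A)) : Prop where
  subset : Pol' ⊆ Pol
  best : ∀ π ∈ Pol', ∃ w ∈ stdSimplex ℝ (Fin m), M.IsBestIn Pol w π
  keep : ∀ π ∈ Pol, (∃ w ∈ stdSimplex ℝ (Fin m), M.IsSoleBestIn Pol w π) →
    ∃ π' ∈ Pol', M.v π' = M.v π

end Values

/-- The polyhedron of the pairs `(w, t)` of a weight vector `w` and a number `t` that is at least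
the scalarized value of every vector in `V`. -/
def polyhedron {m : ℕ} (V : Set (Fin m → ℝ)) : Set ((Fin m → ℝ) × ℝ) :=
  {x | (∀ u ∈ V, u ⬝ᵥ x.1 + (-1) * x.2 ≤ 0) ∧ ∑ i, x.1 i = 1 ∧ ∀ i, 0 ≤ x.1 i}

/-- The corner weights of `V`: the weight vectors in the vertices of the polyhedron. -/
def cornerWeights {m : ℕ} (V : Set (Fin m → ℝ)) : Set (Fin m → ℝ) :=
  Prod.fst '' (polyhedron V).extremePoints ℝ

/-- The variables of GPI Linear Support at the start of an iteration. The set of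
value vectors is determined by the set of policies. -/
structure GPILSState (S A : Type*) (m : ℕ) where
  /-- the current set of policies -/
  Pol : Set (S → A)
  /-- the weight vectors already solved -/
  visited : Set (Fin m → ℝ)

section Algorithm

variable {S A : Type*} {m : ℕ} [Finite S] [Finite A]
  [MeasurableSpace S] [DiscreteMeasurableSpace S]
  [MeasurableSpace A] [DiscreteMeasurableSpace A]

/-- The corner weights of the current value vectors that have not been solved yet. -/
def candidates (M : MOMDP S A m) (σ : GPILSState S A m) : Set (Fin m → ℝ) :=
  cornerWeights (M.valueSet σ.Pol) \ σ.visited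

/-- The algorithm stops, and returns the current policies and value vectors, when no
candidate weight is left. -/
def Halted (M : MOMDP S A m) (σ : GPILSState S A m) : Prop := M.candidates σ = ∅

/-- `w` is a candidate weight with the largest GPI improvement. The GPI policies
used to compute the improvements may break ties in any way. -/
def IsSelected (M : MOMDP S A m) (σ : GPILSState S A m) (w : Fin m → ℝ) : Prop :=
  w ∈ M.candidates σ ∧
    ∃ g : (Fin m → ℝ) → S → A,
      (∀ w' ∈ M.candidates σ, M.IsGPIPolicy σ.Pol w' (g w')) ∧
      ∀ w' ∈ M.candidates σ,
        M.vw w' (g w') - M.bestVw σ.Pol w' ≤ M.vw w (g w) - M.bestVw σ.Pol w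

/-- A (possibly random) subroutine that searches for a policy: `newPolicy w Pol π done` says that
the call with the weight vector `w` and the policies `Pol` may return the policy `π` and
the flag `done`. -/
abbrev NewPolicySubroutine (S A : Type*) (m : ℕ) :=
  (Fin m → ℝ) → Set (S → A) → (S → A) → Bool → Prop

/-- The subroutine answers every call; it always returns an optimal policy for the weight vector
it is given, and reports that it has reached its stopping criterion. -/
structure ReturnsOptimal (M : MOMDP S A m) (newPolicy : NewPolicySubroutine S A m) : Prop where
  returns : ∀ w ∈ stdSimplex ℝ (Fin m), ∀ Pol, ∃ π done, newPolicy w Pol π done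
  optimal : ∀ w ∈ stdSimplex ℝ (Fin m), ∀ Pol π done, newPolicy w Pol π done →
    M.IsOptimal w π ∧ done = true

/-- The possible states after the initialization with the weight vector `(1, 0, …, 0)`. -/
def IsInit [NeZero m] (newPolicy : NewPolicySubroutine S A m) (σ : GPILSState S A m) : Prop :=
  ∃ π done, newPolicy (Pi.single 0 1) ∅ π done ∧ σ.Pol = {π} ∧ σ.visited = ∅

/-- One full iteration of the loop of GPI Linear Support, from the state `σ` to `σ'`. -/
def Step (M : MOMDP S A m) (newPolicy : NewPolicySubroutine S A m)
    (σ σ' : GPILSState S A m) : Prop :=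
  ∃ w π done, M.IsSelected σ w ∧ newPolicy w σ.Pol π done ∧
    σ'.visited = (if done = true then insert w σ.visited else σ.visited) ∧
    M.RemoveDominated (insert π σ.Pol) σ'.Pol

/-- `M.Reach newPolicy n σ`: some run of the algorithm is in the state `σ` after
`n` iterations. -/
inductive Reach [NeZero m] (M : MOMDP S A m) (newPolicy : NewPolicySubroutine S A m) :
    ℕ → GPILSState S A m → Prop
  | init (σ : GPILSState S A m) : IsInit newPolicy σ → Reach M newPolicy 0 σ
  | step (n : ℕ) (σ σ' : GPILSState S A m) : Reach M newPolicy n σ → M.Step newPolicy σ σ' →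
      Reach M newPolicy (n + 1) σ'

end Algorithm

end MOMDP

open Filter Topology

namespace MOMDP

/-! ### Vertices of the polyhedron over the weight simplex, and why they control the envelope. -/

section Polyhedron

variable {m : ℕ} {V : Set (Fin m → ℝ)}

/-! Termination: there are finitely many policies, hence finitely many sets of policies, and each
has finitely many corner weights, since a vertex is determined by its tight inequalities. Every
iteration solves a corner weight not solved before, whichever candidate is chosen, so the number of
all possible corner weights bounds every run.

Correctness: the upper envelope of the value vectors never drops at any weight when dominated
policies are removed (`RemoveDominated.exists_isBestIn`), so solved weights stay solved. At the end
every corner weight is solved. A linear function minus the height is bounded above on the polyhedron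
and attains its maximum at a vertex, so no policy beats the envelope anywhere if none does at the
corners (`exists_le_dotProduct_of_cornerWeights`).

Pareto optimality: an optimum for a strictly positive weight is undominated, and a unique best
vector remains so after perturbing its weight into the interior of the simplex. Such vectors suffice
to attain the envelope (`exists_isBestIn_isSoleBestIn`). -/

theorem mem_stdSimplex_of_mem_polyhedron {x : (Fin m → ℝ) × ℝ} (hx : x ∈ polyhedron V) :
    x.1 ∈ stdSimplex ℝ (Fin m) :=
  ⟨hx.2.2, hx.2.1⟩

theorem mem_stdSimplex_of_mem_cornerWeights {w : Fin m → ℝ} (hw : w ∈ cornerWeights V) :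
    w ∈ stdSimplex ℝ (Fin m) := by
  obtain ⟨x, hx, rfl⟩ := hw
  exact mem_stdSimplex_of_mem_polyhedron hx.1

/-- Two vertices of the polyhedron at which the same inequalities are tight are equal. -/
theorem eq_of_mem_extremePoints_polyhedron (hV : V.Finite) {x y : (Fin m → ℝ) × ℝ}
    (hx : x ∈ (polyhedron V).extremePoints ℝ) (hy : y ∈ polyhedron V)
    (h1 : ∀ u ∈ V, u ⬝ᵥ x.1 + (-1) * x.2 = 0 → u ⬝ᵥ y.1 + (-1) * y.2 = 0)
    (h2 : ∀ i, x.1 i = 0 → y.1 i = 0) : x = y := by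
  have hxP := hx.1
  -- Here `a` and `b` are the slacks of one inequality at `x` and `y`. Moving from `x` slightly away
  -- from `y` keeps a tight inequality tight and a slack one satisfied.
  have key : ∀ a b : ℝ, 0 ≤ a → (a = 0 → b = 0) →
      ∀ᶠ ε in 𝓝[>] (0 : ℝ), 0 ≤ a - ε * (b - a) := by
    intro a b ha hab
    rcases ha.eq_or_lt with h | h
    · refine Eventually.of_forall fun ε => ?_
      rw [hab h.symm, ← h]; simp
    · have : Tendsto (fun ε : ℝ => a - ε * (b - a)) (𝓝[>] 0) (𝓝 (a - 0 * (b - a))) :=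
        (Continuous.tendsto (by fun_prop) 0).mono_left nhdsWithin_le_nhds
      rw [zero_mul, sub_zero] at this
      exact (this.eventually (lt_mem_nhds h)).mono fun _ => le_of_lt
  have e1 : ∀ᶠ ε in 𝓝[>] (0 : ℝ), ∀ u ∈ V,
      0 ≤ -(u ⬝ᵥ x.1 + (-1) * x.2) -
        ε * (-(u ⬝ᵥ y.1 + (-1) * y.2) - -(u ⬝ᵥ x.1 + (-1) * x.2)) := by
    rw [eventually_all_finite hV]
    intro u hu
    refine key _ _ (by linarith [hxP.1 u hu]) fun h => ?_
    rw [h1 u hu (by linarith), neg_zero]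
  have e2 : ∀ᶠ ε in 𝓝[>] (0 : ℝ), ∀ i, 0 ≤ x.1 i - ε * (y.1 i - x.1 i) := by
    rw [eventually_all]
    exact fun i => key _ _ (hxP.2.2 i) (h2 i)
  obtain ⟨ε, ⟨hε1, hε2⟩, hε⟩ := ((e1.and e2).and self_mem_nhdsWithin).exists
  have hε : 0 < ε := hε
  have hz : x - ε • (y - x) ∈ polyhedron V := by
    refine ⟨fun u hu => ?_, ?_, fun i => ?_⟩
    · have := hε1 u hu
      simp only [Prod.fst_sub, Prod.smul_fst, Prod.snd_sub, Prod.smul_snd, dotProduct_sub,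
        dotProduct_smul, smul_eq_mul]
      linarith
    · simp only [Prod.fst_sub, Prod.smul_fst, Pi.sub_apply, Pi.smul_apply, smul_eq_mul,
        Finset.sum_sub_distrib, ← Finset.mul_sum, hxP.2.1, hy.2.1]
      ring
    · simpa using hε2 i
  have hseg : x ∈ openSegment ℝ y (x - ε • (y - x)) := by
    refine ⟨ε / (1 + ε), 1 / (1 + ε), by positivity, by positivity, by field_simp; ring, ?_⟩
    have : ε / (1 + ε) = (1 / (1 + ε)) * ε := by ring
    rw [this, mul_smul, ← smul_add]
    have h3 : ε • y + (x - ε • (y - x)) = (1 + ε) • x := by module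
    rw [h3, smul_smul, one_div, inv_mul_cancel₀ (by positivity), one_smul]
  exact (hx.2 hy hz hseg).symm

/-- The set of tight inequalities is an injective label on vertices and takes finitely many values.
-/
theorem finite_extremePoints_polyhedron (hV : V.Finite) :
    ((polyhedron V).extremePoints ℝ).Finite := by
  let active : (Fin m → ℝ) × ℝ → Set (Fin m → ℝ) × Set (Fin m) := fun x =>
    ({u ∈ V | u ⬝ᵥ x.1 + (-1) * x.2 = 0}, {i | x.1 i = 0})
  refine Set.Finite.of_finite_image (f := active) ?_ ?_
  · refine (hV.finite_subsets.prod (Set.finite_univ (α := Set (Fin m)))).subset ?_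
    rintro _ ⟨x, -, rfl⟩
    exact ⟨Set.sep_subset _ _, trivial⟩
  · intro x hx y hy hxy
    have ha := (Prod.ext_iff.1 hxy).1
    have hb := (Prod.ext_iff.1 hxy).2
    exact eq_of_mem_extremePoints_polyhedron hV hx hy.1
      (fun u hu h => ((Set.ext_iff.1 ha u).1 ⟨hu, h⟩).2) (fun i h => (Set.ext_iff.1 hb i).1 h)

theorem finite_cornerWeights (hV : V.Finite) : (cornerWeights V).Finite :=
  (finite_extremePoints_polyhedron hV).image _

theorem isClosed_polyhedron (V : Set (Fin m → ℝ)) : IsClosed (polyhedron V) := by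
  have : polyhedron V = (⋂ u ∈ V, {x | u ⬝ᵥ x.1 + (-1) * x.2 ≤ 0}) ∩
      Prod.fst ⁻¹' stdSimplex ℝ (Fin m) := by
    ext x
    simp only [polyhedron, stdSimplex, Set.mem_inter_iff, Set.mem_iInter, Set.mem_ofPred_eq,
      Set.mem_preimage]
    tauto
  rw [this]
  refine (isClosed_biInter fun u _ => ?_).inter ((isClosed_stdSimplex ℝ (Fin m)).preimage continuous_fst)
  exact isClosed_le (by fun_prop) continuous_const

/-- A linear function that is at most the upper envelope of `V` at the corner weights
is so at every weight vector. -/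
theorem exists_le_dotProduct_of_cornerWeights (hV : V.Finite) (hne : V.Nonempty) (c : Fin m → ℝ)
    (hc : ∀ w ∈ cornerWeights V, ∃ u ∈ V, c ⬝ᵥ w ≤ u ⬝ᵥ w)
    {w : Fin m → ℝ} (hw : w ∈ stdSimplex ℝ (Fin m)) : ∃ u ∈ V, c ⬝ᵥ w ≤ u ⬝ᵥ w := by
  obtain ⟨b, hb, hbmax⟩ := hV.exists_maximalFor (fun u => u ⬝ᵥ w) V hne
  have hbmax : ∀ u ∈ V, u ⬝ᵥ w ≤ b ⬝ᵥ w := fun u hu =>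
    (le_total (u ⬝ᵥ w) (b ⬝ᵥ w)).elim id fun h => hbmax hu h
  refine ⟨b, hb, ?_⟩
  set x₀ : (Fin m → ℝ) × ℝ := (w, b ⬝ᵥ w) with hx₀
  have hx₀P : x₀ ∈ polyhedron V :=
    ⟨fun u hu => by simpa [hx₀] using hbmax u hu, hw.2, hw.1⟩
  let l : ((Fin m → ℝ) × ℝ) →L[ℝ] ℝ :=
    LinearMap.toContinuousLinearMap
      { toFun := fun x => c ⬝ᵥ x.1 - x.2
        map_add' := fun x y => by simp only [Prod.fst_add, Prod.snd_add, dotProduct_add]; ring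
        map_smul' := fun a x => by
          simp only [Prod.smul_fst, Prod.smul_snd, dotProduct_smul, smul_eq_mul,
            RingHom.id_apply]; ring }
  have hl : ∀ x, l x = c ⬝ᵥ x.1 - x.2 := fun _ => rfl
  -- The polyhedron is unbounded only as the height grows, where `l` tends to minus infinity; so
  -- superlevel sets of `l` are compact and the maximum is attained.
  have hcomp : IsCompact (polyhedron V ∩ {x | l x₀ ≤ l x}) := by
    have hS := isCompact_stdSimplex ℝ (Fin m)
    obtain ⟨B, hB⟩ := (hS.image (f := fun w => c ⬝ᵥ w) (by fun_prop)).bddAbove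
    obtain ⟨B', hB'⟩ := (hS.image (f := fun w => b ⬝ᵥ w) (by fun_prop)).bddBelow
    refine (hS.prod (isCompact_Icc (a := B') (b := B - l x₀))).of_isClosed_subset
      ((isClosed_polyhedron V).inter (isClosed_le continuous_const l.continuous)) ?_
    rintro x ⟨hx, hx'⟩
    have hxS := mem_stdSimplex_of_mem_polyhedron hx
    have h1 := hB ⟨_, hxS, rfl⟩
    have h2 := hB' ⟨_, hxS, rfl⟩
    have h3 := hx.1 b hb
    simp only [Set.mem_ofPred_eq, hl x] at hx'
    exact ⟨hxS, by linarith, by linarith⟩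
  obtain ⟨z, hz, hzmax⟩ := hcomp.exists_isMaxOn ⟨x₀, hx₀P, le_refl (l x₀)⟩ l.continuous.continuousOn
  have hzmax : ∀ y ∈ polyhedron V, l y ≤ l z := by
    intro y hy
    rcases le_total (l x₀) (l y) with h | h
    · exact hzmax ⟨hy, h⟩
    · exact h.trans hz.2
  have hexp : IsExposed ℝ (polyhedron V) (l.toExposed (polyhedron V)) :=
    ContinuousLinearMap.toExposed.isExposed
  have hFcomp : IsCompact (l.toExposed (polyhedron V)) := by
    refine hcomp.of_isClosed_subset (hexp.isClosed (isClosed_polyhedron V)) ?_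
    exact fun x hx => ⟨hx.1, hx.2 x₀ hx₀P⟩
  -- The maximizers of `l` form a compact exposed face; an extreme point of this face is a vertex of
  -- the whole polyhedron.
  obtain ⟨e, he⟩ := hFcomp.extremePoints_nonempty ⟨z, hz.1, hzmax⟩
  have heP := hexp.isExtreme.extremePoints_subset_extremePoints he
  obtain ⟨u, hu, huc⟩ := hc e.1 ⟨e, heP, rfl⟩
  have h1 := heP.1.1 u hu
  have h2 := he.1.2 x₀ hx₀P
  rw [hl, hl] at h2
  simp only [hx₀] at h2
  linarith

end Polyhedron

/-! ### Breaking ties by perturbing the weight, and the effect of removal on the envelope. -/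

section Envelope

variable {S A : Type*} {m : ℕ} [Finite S] [Finite A]
  [MeasurableSpace S] [DiscreteMeasurableSpace S]
  [MeasurableSpace A] [DiscreteMeasurableSpace A]
  {M : MOMDP S A m} {Pol Pol' : Set (S → A)} {w u : Fin m → ℝ} {π : S → A}

theorem exists_isBestIn (M : MOMDP S A m) (hne : Pol.Nonempty) (w : Fin m → ℝ) :
    ∃ π ∈ Pol, M.IsBestIn Pol w π := by
  obtain ⟨π, hπ, h⟩ := Pol.toFinite.exists_maximalFor (M.vw w) Pol hne
  exact ⟨π, hπ, fun π' hπ' => (le_total (M.vw w π') (M.vw w π)).elim id fun h' => h hπ' h'⟩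

theorem vw_congr {π π' : S → A} (h : M.v π = M.v π') (w : Fin m → ℝ) : M.vw w π = M.vw w π' := by
  rw [vw, vw, h]

theorem IsSoleBestIn.isBestIn (h : M.IsSoleBestIn Pol w π) : M.IsBestIn Pol w π := fun π' hπ' => by
  by_cases hv : M.v π' = M.v π
  · exact (vw_congr hv w).le
  · exact (h π' hπ' hv).le

/-- A best policy that wins the ties in the direction of `u` is the only best one for weight
vectors near `w` on the segment to `u`. -/
theorem IsBestIn.eventually_isSoleBestIn (h : M.IsBestIn Pol w π)
    (hu : ∀ π' ∈ Pol, M.v π' ≠ M.v π → M.vw w π' = M.vw w π → M.vw u π' < M.vw u π) :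
    ∀ᶠ ε in 𝓝[>] (0 : ℝ), M.IsSoleBestIn Pol ((1 - ε) • w + ε • u) π := by
  have hvw : ∀ (ε : ℝ) π', M.vw ((1 - ε) • w + ε • u) π' =
      (1 - ε) * M.vw w π' + ε * M.vw u π' := fun ε π' => by
    simp [vw, dotProduct_add, dotProduct_smul]
  simp only [IsSoleBestIn, hvw]
  rw [eventually_all_finite Pol.toFinite]
  intro π' hπ'
  rcases (h π' hπ').eq_or_lt with he | hlt
  · filter_upwards [self_mem_nhdsWithin] with ε hε hne
    have : ε * M.vw u π' < ε * M.vw u π := mul_lt_mul_of_pos_left (hu π' hπ' hne he) hε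
    rw [he]
    linarith
  · have ht : ∀ π' : S → A, Tendsto (fun ε : ℝ => (1 - ε) * M.vw w π' + ε * M.vw u π')
        (𝓝[>] 0) (𝓝 (M.vw w π')) := fun π' => by
      have : Tendsto (fun ε : ℝ => (1 - ε) * M.vw w π' + ε * M.vw u π')
        (𝓝 0) (𝓝 ((1 - 0) * M.vw w π' + 0 * M.vw u π')) := Continuous.tendsto (by fun_prop) 0
      simpa using this.mono_left nhdsWithin_le_nhds
    exact ((ht π').eventually_lt (ht π) hlt).mono fun ε hε _ => hε

/-- Mixing in a little of the strictly positive `u` breaks the ties and makes every coordinate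
positive. -/
theorem IsBestIn.exists_isSoleBestIn (h : M.IsBestIn Pol w π) (hw : w ∈ stdSimplex ℝ (Fin m))
    (hu : ∀ π' ∈ Pol, M.v π' ≠ M.v π → M.vw w π' = M.vw w π → M.vw u π' < M.vw u π)
    (huS : u ∈ stdSimplex ℝ (Fin m)) (hpos : ∀ i, 0 < u i) :
    ∃ w' ∈ stdSimplex ℝ (Fin m), (∀ i, 0 < w' i) ∧ M.IsSoleBestIn Pol w' π := by
  have h1 : ∀ᶠ ε in 𝓝[>] (0 : ℝ), ε < 1 := nhdsWithin_le_nhds (gt_mem_nhds one_pos)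
  obtain ⟨ε, ⟨hε, hε1⟩, hε0⟩ :=
    (((h.eventually_isSoleBestIn hu).and h1).and self_mem_nhdsWithin).exists
  have hε0 : 0 < ε := hε0
  refine ⟨_, convex_stdSimplex ℝ (Fin m) hw huS (sub_nonneg.2 hε1.le) hε0.le (by ring),
    fun i => ?_, hε⟩
  have := mul_pos hε0 (hpos i)
  have := mul_nonneg (sub_nonneg.2 hε1.le) (hw.1 i)
  simp only [Pi.add_apply, Pi.smul_apply, smul_eq_mul]
  linarith

variable [NeZero m]

/-- Dividing a positive vector by the sum of its coordinates gives a weight vector. -/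
theorem inv_sum_smul_mem_stdSimplex {p : Fin m → ℝ} (hp : ∀ i, 0 < p i) :
    0 < ∑ i, p i ∧ (∑ i, p i)⁻¹ • p ∈ stdSimplex ℝ (Fin m) := by
  have hs : 0 < ∑ i, p i := Finset.sum_pos (fun i _ => hp i) Finset.univ_nonempty
  refine ⟨hs, fun i => mul_nonneg (inv_nonneg.2 hs.le) (hp i).le, ?_⟩
  simp only [Pi.smul_apply, smul_eq_mul, ← Finset.mul_sum]
  exact inv_mul_cancel₀ hs.ne'

/-- Perturb towards the uniform weight: with no competing vector tied, the tie-breaking condition is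
vacuous. -/
theorem IsSoleBestIn.exists_pos (h : M.IsSoleBestIn Pol w π) (hw : w ∈ stdSimplex ℝ (Fin m)) :
    ∃ w' ∈ stdSimplex ℝ (Fin m), (∀ i, 0 < w' i) ∧ M.IsSoleBestIn Pol w' π := by
  obtain ⟨hs, hS⟩ := inv_sum_smul_mem_stdSimplex (m := m) (p := fun _ => 1) fun _ => one_pos
  exact h.isBestIn.exists_isSoleBestIn hw
    (fun π' hπ' hne he => absurd he (h π' hπ' hne).ne) hS fun i => mul_pos (inv_pos.2 hs) one_pos

/-- For every weight vector, some best policy is the only best one for a suitable weight vector. -/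
theorem exists_isBestIn_isSoleBestIn (M : MOMDP S A m) (hne : Pol.Nonempty)
    (hw : w ∈ stdSimplex ℝ (Fin m)) :
    ∃ π ∈ Pol, M.IsBestIn Pol w π ∧ ∃ w' ∈ stdSimplex ℝ (Fin m), M.IsSoleBestIn Pol w' π := by
  -- The shift by `c` makes all value vectors strictly positive, so the longest one can be
  -- normalized to a weight. Scalarized differences are unaffected.
  obtain ⟨c, hc⟩ : ∃ c : ℝ, ∀ x : (S → A) × Fin m, -M.v x.1 x.2 < c := by
    obtain ⟨B, hB⟩ := (Set.finite_range fun x : (S → A) × Fin m => -M.v x.1 x.2).bddAbove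
    exact ⟨B + 1, fun x => (hB ⟨x, rfl⟩).trans_lt (lt_add_one B)⟩
  obtain ⟨p, hpv⟩ : ∃ p : (S → A) → Fin m → ℝ, ∀ π, p π = M.v π + fun _ => c :=
    ⟨_, fun _ => rfl⟩
  have hp : ∀ π i, 0 < p π i := fun π i => by
    rw [hpv, Pi.add_apply]
    linarith [hc (π, i)]
  obtain ⟨π₀, hπ₀, hb₀⟩ := exists_isBestIn M hne w
  -- among the best policies, take the one with the longest shifted value vector
  obtain ⟨π, ⟨hπ, hb⟩, hmax⟩ := (Set.toFinite {π ∈ Pol | M.IsBestIn Pol w π}).exists_maximalFor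
    (fun π => p π ⬝ᵥ p π) _ ⟨π₀, hπ₀, hb₀⟩
  obtain ⟨hs, hS⟩ := inv_sum_smul_mem_stdSimplex (hp π)
  refine ⟨π, hπ, hb, ?_⟩
  suffices hu : ∀ π' ∈ Pol, M.v π' ≠ M.v π → M.vw w π' = M.vw w π →
      M.vw ((∑ i, p π i)⁻¹ • p π) π' < M.vw ((∑ i, p π i)⁻¹ • p π) π by
    obtain ⟨w', hw', -, h⟩ := hb.exists_isSoleBestIn hw hu hS
      fun i => mul_pos (inv_pos.2 hs) (hp π i)
    exact ⟨w', hw', h⟩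
  intro π' hπ' hv he
  have hb' : M.IsBestIn Pol w π' := fun π'' h'' => (hb π'' h'').trans_eq he.symm
  have hle : p π' ⬝ᵥ p π' ≤ p π ⬝ᵥ p π := by
    rcases le_total (p π' ⬝ᵥ p π') (p π ⬝ᵥ p π) with h | h
    · exact h
    · exact hmax ⟨hπ', hb'⟩ h
  -- Expanding this square with `hle` gives `p π' ⬝ᵥ p π < p π ⬝ᵥ p π`: the longest vector wins in
  -- its own direction.
  have hd : 0 < (p π - p π') ⬝ᵥ (p π - p π') := by
    refine lt_of_le_of_ne (Finset.sum_nonneg fun i _ => mul_self_nonneg _) fun h => hv ?_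
    have := sub_eq_zero.1 (dotProduct_self_eq_zero.1 h.symm)
    rw [hpv, hpv] at this
    exact (add_right_cancel this).symm
  have hlt : M.v π' ⬝ᵥ p π < M.v π ⬝ᵥ p π := by
    have hsplit : ∀ π', M.v π' ⬝ᵥ p π = p π' ⬝ᵥ p π - (fun _ => c) ⬝ᵥ p π := fun π' => by
      rw [← sub_dotProduct, hpv π', add_sub_cancel_right]
    rw [hsplit, hsplit]
    simp only [sub_dotProduct, dotProduct_sub] at hd
    rw [dotProduct_comm (p π) (p π')] at hd
    linarith
  simp only [vw, dotProduct_smul, smul_eq_mul]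
  exact mul_lt_mul_of_pos_left hlt (inv_pos.2 hs)

/-- A policy best only in ties may vanish, but some policy tied with it is the sole best elsewhere,
so its value vector is kept. -/
theorem RemoveDominated.exists_isBestIn (h : M.RemoveDominated Pol Pol') (hne : Pol.Nonempty)
    (hw : w ∈ stdSimplex ℝ (Fin m)) : ∃ π ∈ Pol', M.IsBestIn Pol w π := by
  obtain ⟨π, hπ, hb, hs⟩ := exists_isBestIn_isSoleBestIn M hne hw
  obtain ⟨π', hπ', hv⟩ := h.keep π hπ hs
  exact ⟨π', hπ', fun π'' h'' => (hb π'' h'').trans (vw_congr hv w).ge⟩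

end Envelope

/-! ### The loop invariant, progress of a run, and the state at return. -/

section Run

variable {S A : Type*} {m : ℕ} [Finite S] [Finite A]
  [MeasurableSpace S] [DiscreteMeasurableSpace S]
  [MeasurableSpace A] [DiscreteMeasurableSpace A]
  {M : MOMDP S A m} {newPolicy : NewPolicySubroutine S A m} {σ σ' : GPILSState S A m}

theorem exists_removeDominated (M : MOMDP S A m) (Pol : Set (S → A)) :
    ∃ Pol', M.RemoveDominated Pol Pol' :=
  ⟨{π ∈ Pol | ∃ w ∈ stdSimplex ℝ (Fin m), M.IsBestIn Pol w π}, Set.sep_subset _ _,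
    fun _ hπ => hπ.2, fun π hπ ⟨w, hw, h⟩ => ⟨π, ⟨hπ, w, hw, h.isBestIn⟩, rfl⟩⟩

theorem exists_isGPIPolicy [Nonempty A] (M : MOMDP S A m) (Pol : Set (S → A)) (w : Fin m → ℝ) :
    ∃ g, M.IsGPIPolicy Pol w g := by
  choose g hg using fun s => Finite.exists_max fun a => sSup ((fun π => M.qw w π s a) '' Pol)
  exact ⟨g, hg⟩

theorem finite_valueSet (M : MOMDP S A m) (Pol : Set (S → A)) : (M.valueSet Pol).Finite :=
  Pol.toFinite.image _

theorem exists_isSelected [Nonempty A] (h : ¬ M.Halted σ) : ∃ w, M.IsSelected σ w := by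
  choose g hg using exists_isGPIPolicy M σ.Pol
  have hfin : (M.candidates σ).Finite := (finite_cornerWeights (finite_valueSet M _)).sdiff
  obtain ⟨w, hw, hmax⟩ := hfin.exists_maximalFor
    (fun w => M.vw w (g w) - M.bestVw σ.Pol w) _ (Set.nonempty_iff_ne_empty.2 h)
  exact ⟨w, hw, g, fun w' _ => hg w', fun w' hw' => (le_total _ _).elim id fun h' => hmax hw' h'⟩

theorem ReturnsOptimal.exists_step [Nonempty A] (hN : M.ReturnsOptimal newPolicy)
    (h : ¬ M.Halted σ) : ∃ σ', M.Step newPolicy σ σ' := by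
  obtain ⟨w, hw⟩ := exists_isSelected h
  obtain ⟨π, done, hπ⟩ := hN.returns w (mem_stdSimplex_of_mem_cornerWeights hw.1.1) σ.Pol
  obtain ⟨Pol', hPol'⟩ := exists_removeDominated M (insert π σ.Pol)
  exact ⟨⟨Pol', if done = true then insert w σ.visited else σ.visited⟩, w, π, done, hw, hπ, rfl,
    hPol'⟩

/-- The weight vectors that can be corner weights at some point of some run. -/
def possibleCorners (M : MOMDP S A m) : Set (Fin m → ℝ) :=
  ⋃ Pol : Set (S → A), cornerWeights (M.valueSet Pol)

theorem finite_possibleCorners (M : MOMDP S A m) : M.possibleCorners.Finite :=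
  Set.finite_iUnion fun Pol => finite_cornerWeights (finite_valueSet M Pol)

/-- The loop invariant of GPI Linear Support after `n` iterations. -/
structure Invariant (M : MOMDP S A m) (n : ℕ) (σ : GPILSState S A m) : Prop where
  nonempty : σ.Pol.Nonempty
  best : ∀ π ∈ σ.Pol, ∃ w ∈ stdSimplex ℝ (Fin m), M.IsBestIn σ.Pol w π
  visited_subset : σ.visited ⊆ M.possibleCorners
  ncard_visited : σ.visited.ncard = n
  solved : ∀ w ∈ σ.visited, ∃ π ∈ σ.Pol, M.IsOptimal w π

theorem IsBestIn.isOptimal {Pol : Set (S → A)} {w : Fin m → ℝ} {π : S → A}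
    (h : M.IsBestIn Pol w π) (hopt : ∃ π' ∈ Pol, M.IsOptimal w π') : M.IsOptimal w π := by
  obtain ⟨π', h', hopt⟩ := hopt
  exact fun π'' => (hopt π'').trans (h π' h')

theorem IsOptimal.mem_paretoFrontier {w : Fin m → ℝ} {π : S → A} (h : M.IsOptimal w π)
    (hpos : ∀ i, 0 < w i) : M.v π ∈ M.paretoFrontier := by
  refine ⟨π, rfl, ?_⟩
  rintro ⟨π', hle, i, hi⟩
  refine (h π').not_gt (Finset.sum_lt_sum (fun j _ => ?_) ⟨i, Finset.mem_univ i, ?_⟩)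
  · exact mul_le_mul_of_nonneg_right (hle j) (hpos j).le
  · exact mul_lt_mul_of_pos_right hi (hpos i)

/-- At return all corner weights are solved, so the value of a policy optimal at `w` lies below the
envelope at the corners, hence at `w`. -/
theorem Invariant.exists_isOptimal {n : ℕ} (hI : M.Invariant n σ) (hH : M.Halted σ)
    {w : Fin m → ℝ} (hw : w ∈ stdSimplex ℝ (Fin m)) : ∃ π ∈ σ.Pol, M.IsOptimal w π := by
  obtain ⟨π₀, h₀⟩ := hI.nonempty
  obtain ⟨π, -, hπ⟩ := exists_isBestIn M (Pol := Set.univ) ⟨π₀, trivial⟩ w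
  have hcorner : ∀ w' ∈ cornerWeights (M.valueSet σ.Pol),
      ∃ u ∈ M.valueSet σ.Pol, M.v π ⬝ᵥ w' ≤ u ⬝ᵥ w' := fun w' hw' => by
    have hvis : w' ∈ σ.visited := by
      by_contra hn
      exact (Set.ext_iff.1 hH w').1 ⟨hw', hn⟩
    obtain ⟨π₁, h₁, hopt⟩ := hI.solved w' hvis
    exact ⟨_, ⟨π₁, h₁, rfl⟩, hopt π⟩
  obtain ⟨u, ⟨π', hπ', rfl⟩, hle⟩ := exists_le_dotProduct_of_cornerWeights
    (finite_valueSet M σ.Pol) ⟨_, π₀, h₀, rfl⟩ (M.v π) hcorner hw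
  exact ⟨π', hπ', fun π'' => (hπ π'' trivial).trans hle⟩

theorem Invariant.isCCS {n : ℕ} (hI : M.Invariant n σ) (hH : M.Halted σ) :
    M.IsCCS (M.valueSet σ.Pol) where
  finite := finite_valueSet M _
  optimal_somewhere := by
    rintro _ ⟨π, hπ, rfl⟩
    obtain ⟨w, hw, hb⟩ := hI.best π hπ
    exact ⟨π, rfl, w, hw, hb.isOptimal (hI.exists_isOptimal hH hw)⟩
  covers w hw := by
    obtain ⟨π, hπ, h⟩ := hI.exists_isOptimal hH hw
    exact ⟨π, ⟨π, hπ, rfl⟩, h⟩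

variable [NeZero m]

theorem single_mem_stdSimplex_zero : (Pi.single 0 1 : Fin m → ℝ) ∈ stdSimplex ℝ (Fin m) :=
  single_mem_stdSimplex ℝ 0

theorem invariant_of_isInit (h : IsInit newPolicy σ) : M.Invariant 0 σ := by
  obtain ⟨π, done, -, hP, hv⟩ := h
  refine ⟨?_, ?_, ?_, ?_, ?_⟩
  · simp [hP]
  · intro π' hπ'
    rw [hP, Set.mem_singleton_iff] at hπ'
    refine ⟨_, single_mem_stdSimplex_zero, fun π'' h'' => ?_⟩
    rw [hP, Set.mem_singleton_iff] at h''
    rw [hπ', h'']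
  · simp [hv]
  · simp [hv]
  · simp [hv]

theorem Invariant.step {n : ℕ} (hN : M.ReturnsOptimal newPolicy) (hI : M.Invariant n σ)
    (h : M.Step newPolicy σ σ') : M.Invariant (n + 1) σ' := by
  obtain ⟨w, π, done, hw, hπ, hvis, hrem⟩ := h
  have hwS := mem_stdSimplex_of_mem_cornerWeights hw.1.1
  obtain ⟨hopt, rfl⟩ := hN.optimal w hwS _ _ _ hπ
  rw [if_pos rfl] at hvis
  have hcorner : w ∈ M.possibleCorners := Set.mem_iUnion.2 ⟨_, hw.1.1⟩
  have hsub : insert w σ.visited ⊆ M.possibleCorners := Set.insert_subset hcorner hI.visited_subset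
  have hne : (insert π σ.Pol).Nonempty := Set.insert_nonempty _ _
  refine ⟨?_, ?_, hvis ▸ hsub, ?_, ?_⟩
  · obtain ⟨π', h', -⟩ := hrem.exists_isBestIn hne hwS
    exact ⟨π', h'⟩
  · intro π' h'
    obtain ⟨w', hw', hb⟩ := hrem.best π' h'
    exact ⟨w', hw', fun π'' h'' => hb π'' (hrem.subset h'')⟩
  -- The selected weight is an unvisited candidate, so the count grows by exactly one.
  · rw [hvis, Set.ncard_insert_of_notMem hw.1.2
      (M.finite_possibleCorners.subset hI.visited_subset), hI.ncard_visited]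
  · intro w' hw'
    rw [hvis] at hw'
    obtain ⟨π₁, h₁, hopt₁⟩ : ∃ π₁ ∈ insert π σ.Pol, M.IsOptimal w' π₁ := by
      rcases hw' with rfl | hw'
      · exact ⟨π, Set.mem_insert _ _, hopt⟩
      · obtain ⟨π₁, h₁, hopt₁⟩ := hI.solved w' hw'
        exact ⟨π₁, Set.mem_insert_of_mem _ h₁, hopt₁⟩
    have hw'S : w' ∈ stdSimplex ℝ (Fin m) := by
      obtain ⟨Pol, hPol⟩ := Set.mem_iUnion.1 (hsub hw')
      exact mem_stdSimplex_of_mem_cornerWeights hPol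
    obtain ⟨π₂, h₂, hb⟩ := hrem.exists_isBestIn hne hw'S
    exact ⟨π₂, h₂, fun π' => (hopt₁ π').trans (hb π₁ h₁)⟩

theorem Reach.invariant {n : ℕ} (hN : M.ReturnsOptimal newPolicy) (h : M.Reach newPolicy n σ) :
    M.Invariant n σ := by
  induction h with
  | init σ h => exact invariant_of_isInit h
  | step n σ σ' _ h ih => exact ih.step hN h

/-- Optimality at a weight with zero coordinates does not exclude Pareto dominance; hence the move
to a strictly positive weight. -/
theorem IsSoleBestIn.mem_paretoFrontier {Pol : Set (S → A)} {w : Fin m → ℝ} {π : S → A}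
    (hopt : ∀ w ∈ stdSimplex ℝ (Fin m), ∃ π ∈ Pol, M.IsOptimal w π)
    (hw : w ∈ stdSimplex ℝ (Fin m)) (h : M.IsSoleBestIn Pol w π) : M.v π ∈ M.paretoFrontier := by
  obtain ⟨w', hw', hpos, h'⟩ := h.exists_pos hw
  exact (h'.isBestIn.isOptimal (hopt w' hw')).mem_paretoFrontier hpos

theorem Invariant.isCCS_inter_paretoFrontier {n : ℕ} (hI : M.Invariant n σ) (hH : M.Halted σ) :
    M.IsCCS (M.valueSet σ.Pol ∩ M.paretoFrontier) where
  finite := (finite_valueSet M _).inter_of_left _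
  optimal_somewhere u hu := (hI.isCCS hH).optimal_somewhere u hu.1
  covers w hw := by
    obtain ⟨π, hπ, hb, w', hw', hs⟩ := exists_isBestIn_isSoleBestIn M hI.nonempty hw
    exact ⟨π, ⟨⟨π, hπ, rfl⟩, hs.mem_paretoFrontier (fun w hw => hI.exists_isOptimal hH hw) hw'⟩,
      hb.isOptimal (hI.exists_isOptimal hH hw)⟩

end Run

end MOMDP

theorem theorem2 {S A : Type*} {m : ℕ} [NeZero m] [Finite S] [Finite A] [Nonempty A]
    [MeasurableSpace S] [DiscreteMeasurableSpace S]
    [MeasurableSpace A] [DiscreteMeasurableSpace A] (M : MOMDP S A m) :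
    -- the bound on the number of iterations depends on the MOMDP only
    ∃ N : ℕ, ∀ newPolicy : MOMDP.NewPolicySubroutine S A m, M.ReturnsOptimal newPolicy →
      -- the algorithm starts
      (∃ σ, M.Reach newPolicy 0 σ) ∧
      ∀ n σ, M.Reach newPolicy n σ →
        -- no run exceeds `N` iterations
        n ≤ N ∧
        -- a run that has not returned can go on
        (¬ M.Halted σ → ∃ σ', M.Step newPolicy σ σ') ∧
        -- what is returned is a CCS
        (M.Halted σ →
          M.IsCCS (M.valueSet σ.Pol) ∧
          -- its Pareto optimal members alone are a CCS
          M.IsCCS (M.valueSet σ.Pol ∩ M.paretoFrontier) ∧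
          -- members that are best not only in ties are Pareto optimal
          ∀ π ∈ σ.Pol, (∃ w ∈ stdSimplex ℝ (Fin m), M.IsSoleBestIn σ.Pol w π) →
            M.v π ∈ M.paretoFrontier) := by
  refine ⟨M.possibleCorners.ncard, fun newPolicy hN => ⟨?_, fun n σ hR => ?_⟩⟩
  · obtain ⟨π, done, hπ⟩ := hN.returns _ MOMDP.single_mem_stdSimplex_zero ∅
    exact ⟨⟨{π}, ∅⟩, .init _ ⟨π, done, hπ, rfl, rfl⟩⟩
  · have hI := hR.invariant hN
    refine ⟨?_, hN.exists_step, fun hH => ⟨hI.isCCS hH, hI.isCCS_inter_paretoFrontier hH, ?_⟩⟩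
    · rw [← hI.ncard_visited]
      exact Set.ncard_le_ncard hI.visited_subset M.finite_possibleCorners
    · rintro π - ⟨w, hw, h⟩
      exact h.mem_paretoFrontier (fun w hw => hI.exists_isOptimal hH hw) hw
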